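/- Let $X$ be either $C[0,2\pi]$ or $L^p[0,2\pi]$ for some $1\le p\le\infty$ (real-valued functions, Lebesgue measure, with the pointwise, respectively almost everywhere, order), and let $\mathscr S\colon X\to X$ be the integral operator $$(\mathscr S f)(s)=\int_0^{2\pi} f(t)\,(1+\cos(s-t))\,dt ,$$ where for $X=L^p[0,2\pi]$ the equality is meant for almost every $s\in[0,2\pi]$. For a positive operator $T\colon X\to Y$ between ordered vector spaces, the nonnegative rank $\operatorname{rank}^+(T)$ is the least dimension of a finite-dimensional Archimedean vector lattice $Z$ for which there are positive linear operators $R\colon X\to Z$ and $L\colon Z\to Y$ with $T=LR$, and $\operatorname{rank}^+(T)=\infty$ if no such $Z$ exists. Then $\mathscr S$ is a positive operator of rank three, and $\operatorname{rank}^+(\mathscr S)=\infty$. Moreover, $\mathscr S$ is not a finite sum $\sum_{j=1}^k y_j\otimes\varphi_j$ with positive vectors $y_j\in X$ and positive linear functionals $\varphi_j$ on $X$, where $(y\otimes\varphi)(x)=\varphi(x)\,y$. -/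

import Mathlib

open MeasureTheory
open scoped ENNReal

attribute [local instance] MeasureTheory.Measure.Subtype.measureSpace

section NonnegativeRank

variable {X Y : Type*} [AddCommGroup X] [PartialOrder X] [Module ℝ X]
  [AddCommGroup Y] [PartialOrder Y] [Module ℝ Y]

/-- `T` factors as `T = L R` with positive operators `R : X → Z` and `L : Z → Y` through an
`n`-dimensional Archimedean vector lattice `Z`. Here `Archimedean` is meant in the sense of ordered
vector spaces: if `m • x ≤ y` for all natural numbers `m`, then `x ≤ 0`. Taking `Z : Type` is no
restriction, as every finite-dimensional vector lattice can be transported to `Fin n → ℝ` along a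
linear isomorphism. -/
def HasPositiveFactorization (T : X →ₗ[ℝ] Y) (n : ℕ) : Prop :=
  ∃ (Z : Type) (_ : AddCommGroup Z) (_ : Lattice Z) (_ : IsOrderedAddMonoid Z)
    (_ : Module ℝ Z) (_ : IsOrderedModule ℝ Z),
    FiniteDimensional ℝ Z ∧ Module.finrank ℝ Z = n ∧
    (∀ x y : Z, (∀ m : ℕ, m • x ≤ y) → x ≤ 0) ∧
    ∃ (R : X →ₚ[ℝ] Z) (L : Z →ₚ[ℝ] Y), ∀ x, T x = L (R x)

/-- The nonnegative rank of `T`: the least dimension of a finite-dimensional Archimedean vector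
lattice through which `T` factors with positive factors, and `⊤` if there is none. -/
noncomputable def nonnegRank (T : X →ₗ[ℝ] Y) : ℕ∞ :=
  ⨅ (n : ℕ) (_ : HasPositiveFactorization T n), (n : ℕ∞)

/-- `T` is a finite sum of rank-one operators `y ⊗ φ : x ↦ φ x • y` with a positive vector `y` and a
positive linear functional `φ` (the functionals are not assumed to be continuous). -/
def IsSumOfPositiveTensors (T : X →ₗ[ℝ] Y) : Prop :=
  ∃ (k : ℕ) (y : Fin k → Y) (φ : Fin k → (X →ₚ[ℝ] ℝ)),
    (∀ j, 0 ≤ y j) ∧ ∀ x, T x = ∑ j, φ j x • y j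

end NonnegativeRank

section Operator

/-- The interval `[0, 2π]`; as a subtype of `ℝ` it carries Lebesgue measure `volume`. -/
abbrev IccTwoPi : Type := Set.Icc (0 : ℝ) (2 * Real.pi)

instance IccTwoPi.isFiniteMeasure : IsFiniteMeasure (volume : Measure IccTwoPi) := by
  refine ⟨?_⟩
  rw [Measure.Subtype.volume_univ measurableSet_Icc.nullMeasurableSet]
  exact measure_Icc_lt_top

/-- The function `s ↦ ∫₀^{2π} f(t) (1 + cos (s - t)) dt` on `[0, 2π]`. -/
noncomputable def cosIntegral (f : IccTwoPi → ℝ) (s : IccTwoPi) : ℝ :=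
  ∫ t : IccTwoPi, f t * (1 + Real.cos ((s : ℝ) - (t : ℝ)))

theorem cosKernel_norm_le (a : ℝ) : ‖1 + Real.cos a‖ ≤ 2 := by
  rw [Real.norm_eq_abs, abs_le]
  constructor <;> linarith [Real.neg_one_le_cos a, Real.cos_le_one a]

theorem integrable_mul_cosKernel {f : IccTwoPi → ℝ} (hf : Integrable f) (s : IccTwoPi) :
    Integrable fun t : IccTwoPi => f t * (1 + Real.cos ((s : ℝ) - (t : ℝ))) :=
  hf.mul_bdd (c := 2) (by fun_prop) (.of_forall fun _ => cosKernel_norm_le _)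

theorem continuous_cosIntegral {f : IccTwoPi → ℝ} (hf : Integrable f) :
    Continuous (cosIntegral f) := by
  refine continuous_of_dominated (bound := fun t => ‖f t‖ * 2)
    (fun s => (integrable_mul_cosKernel hf s).aestronglyMeasurable) (fun s => ?_)
    (hf.norm.mul_const 2) (.of_forall fun t => by fun_prop)
  refine .of_forall fun t => ?_
  rw [norm_mul]
  exact mul_le_mul_of_nonneg_left (cosKernel_norm_le _) (norm_nonneg _)

theorem memLp_cosIntegral {f : IccTwoPi → ℝ} (hf : Integrable f) (p : ℝ≥0∞) :
    MemLp (cosIntegral f) p volume := by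
  obtain ⟨C, hC⟩ := isCompact_univ.exists_bound_of_continuousOn
    (continuous_cosIntegral hf).continuousOn
  exact MemLp.of_bound (continuous_cosIntegral hf).aestronglyMeasurable C
    (.of_forall fun s => hC s (Set.mem_univ s))

theorem cosIntegral_congr {f g : IccTwoPi → ℝ} (h : f =ᵐ[volume] g) :
    cosIntegral f = cosIntegral g := by
  funext s
  exact integral_congr_ae (h.mono fun t ht => by simp only [ht])

theorem cosIntegral_add {f g : IccTwoPi → ℝ} (hf : Integrable f) (hg : Integrable g) :
    cosIntegral (f + g) = cosIntegral f + cosIntegral g := by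
  funext s
  simp only [cosIntegral, Pi.add_apply, add_mul]
  exact integral_add (integrable_mul_cosKernel hf s) (integrable_mul_cosKernel hg s)

theorem cosIntegral_smul (c : ℝ) (f : IccTwoPi → ℝ) :
    cosIntegral (c • f) = c • cosIntegral f := by
  funext s
  simp only [cosIntegral, Pi.smul_apply, smul_eq_mul, mul_assoc]
  exact integral_const_mul c _

theorem IccTwoPi.integrable_continuousMap (f : C(IccTwoPi, ℝ)) : Integrable (f : IccTwoPi → ℝ) :=
  f.continuous.integrable_of_hasCompactSupport (HasCompactSupport.of_compactSpace _)

theorem IccTwoPi.integrable_Lp {p : ℝ≥0∞} [hp : Fact (1 ≤ p)]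
    (f : Lp ℝ p (volume : Measure IccTwoPi)) : Integrable (f : IccTwoPi → ℝ) :=
  (Lp.memLp f).integrable hp.out

/-- The operator `(𝒮 f)(s) = ∫₀^{2π} f(t) (1 + cos (s - t)) dt` on `C[0, 2π]`. -/
noncomputable def opC : C(IccTwoPi, ℝ) →ₗ[ℝ] C(IccTwoPi, ℝ) where
  toFun f := ⟨cosIntegral f, continuous_cosIntegral (IccTwoPi.integrable_continuousMap f)⟩
  map_add' f g := DFunLike.coe_injective
    (cosIntegral_add (IccTwoPi.integrable_continuousMap f) (IccTwoPi.integrable_continuousMap g))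
  map_smul' c f := DFunLike.coe_injective (cosIntegral_smul c f)

/-- The operator `(𝒮 f)(s) = ∫₀^{2π} f(t) (1 + cos (s - t)) dt` (for almost every `s`) on
`L^p[0, 2π]`, where `1 ≤ p ≤ ∞`. -/
noncomputable def opLp (p : ℝ≥0∞) [Fact (1 ≤ p)] :
    Lp ℝ p (volume : Measure IccTwoPi) →ₗ[ℝ] Lp ℝ p (volume : Measure IccTwoPi) where
  toFun f := (memLp_cosIntegral (IccTwoPi.integrable_Lp f) p).toLp (cosIntegral f)
  map_add' f g := by
    rw [← MemLp.toLp_add]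
    refine MemLp.toLp_congr _ _ (.of_forall fun s => ?_)
    rw [cosIntegral_congr (Lp.coeFn_add f g),
      cosIntegral_add (IccTwoPi.integrable_Lp f) (IccTwoPi.integrable_Lp g)]
  map_smul' c f := by
    rw [RingHom.id_apply, ← MemLp.toLp_const_smul]
    refine MemLp.toLp_congr _ _ (.of_forall fun s => ?_)
    rw [cosIntegral_congr (Lp.coeFn_smul c f), cosIntegral_smul]

end Operator

/-! ### Finite-dimensional Archimedean vector lattices. -/

section VectorLattice

variable {Z : Type*} [AddCommGroup Z] [Lattice Z] [IsOrderedAddMonoid Z]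

/-! A finite-dimensional Archimedean vector lattice is `ℝ^k` with the coordinatewise order: a
largest set of pairwise disjoint nonzero positive vectors is a positive basis with positive
coordinate functionals (`exists_positive_basis`). Expanding the middle of a factorization in this
basis turns it into a finite sum of positive tensors, so both negative claims reduce to excluding
such sums.

Suppose `𝒮 = ∑ y_j ⊗ φ_j`. There are at most `2^k` zero patterns of `(y_1(s), …, y_k(s))`, so two
distinct interior points `s`, `s'` share one, and then `(𝒮 f)(s) ≤ C (𝒮 f)(s')` with `C` independent
of the test function `f` (`exists_ne_forall_le_mul`). Testing on squares gives `1 + cos(s - t) ≤ C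
(1 + cos(s' - t))` for every `t` (`eq_of_forall_cosIntegral_le`). At the point `t` antipodal to `s'`
the right side vanishes, which forces `s = s'`. In `L^p` identities hold only almost everywhere, so
the tests run over a countable dense set and a density argument recovers the rest.

The rank is three because the addition formula for the cosine makes the kernel degenerate, with
range spanned by `1`, `cos`, `sin`. -/

theorem inf_add_eq_zero {x y z : Z} (hx : 0 ≤ x) (hy : 0 ≤ y) (hz : 0 ≤ z)
    (hxy : x ⊓ y = 0) (hxz : x ⊓ z = 0) : x ⊓ (y + z) = 0 := by
  refine le_antisymm ?_ (le_inf hx (add_nonneg hy hz))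
  -- After subtracting `z`, the meet lies below `x ⊓ y = 0`; so the meet itself lies below `z` as
  -- well as below `x`.
  have h1 : x ⊓ (y + z) - z ≤ x ⊓ y :=
    le_inf (sub_le_iff_le_add.2 (inf_le_left.trans (le_add_of_nonneg_right hz)))
      (sub_le_iff_le_add.2 inf_le_right)
  rw [hxy, sub_nonpos] at h1
  exact (le_inf inf_le_left h1).trans hxz.le

theorem inf_eq_zero_of_le {Z : Type*} [AddCommGroup Z] [Lattice Z] {x y z : Z}
    (hx : 0 ≤ x) (hz : 0 ≤ z) (hzy : z ≤ y)
    (hxy : x ⊓ y = 0) : x ⊓ z = 0 :=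
  le_antisymm ((inf_le_inf_left x hzy).trans hxy.le) (le_inf hx hz)

theorem inf_sum_eq_zero {ι : Type*} {x : Z} (hx : 0 ≤ x) (s : Finset ι) (f : ι → Z)
    (hf : ∀ i ∈ s, 0 ≤ f i) (h : ∀ i ∈ s, x ⊓ f i = 0) : x ⊓ ∑ i ∈ s, f i = 0 := by
  classical
  induction s using Finset.induction_on with
  | empty => simpa using hx
  | insert a s ha ih =>
    rw [Finset.sum_insert ha]
    exact inf_add_eq_zero hx (hf a (by simp)) (Finset.sum_nonneg fun i hi => hf i (by simp [hi]))
      (h a (by simp)) (ih (fun i hi => hf i (by simp [hi])) fun i hi => h i (by simp [hi]))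

theorem inf_nsmul_eq_zero {x y : Z} (hx : 0 ≤ x) (hy : 0 ≤ y) (hxy : x ⊓ y = 0) (n : ℕ) :
    x ⊓ n • y = 0 := by
  simpa using inf_sum_eq_zero hx (Finset.range n) (fun _ => y) (fun _ _ => hy) fun _ _ => hxy

variable [Module ℝ Z] [IsOrderedModule ℝ Z]

theorem inf_smul_eq_zero {x y : Z} (hx : 0 ≤ x) (hy : 0 ≤ y) (hxy : x ⊓ y = 0) {c : ℝ}
    (hc : 0 ≤ c) : x ⊓ c • y = 0 := by
  obtain ⟨n, hn⟩ := exists_nat_ge c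
  refine inf_eq_zero_of_le hx (smul_nonneg hc hy) ?_ (inf_nsmul_eq_zero hx hy hxy n)
  rw [← Nat.cast_smul_eq_nsmul ℝ]
  exact smul_le_smul_of_nonneg_right hn hy

/-- A finite set of pairwise disjoint positive nonzero elements. -/
def IsDisjointSystem (S : Finset Z) : Prop :=
  (∀ e ∈ S, 0 ≤ e ∧ e ≠ 0) ∧ ∀ e ∈ S, ∀ f ∈ S, e ≠ f → e ⊓ f = 0

/-- If `c e < 0`, moving that term across the inequality puts `(-c e) • e` below a combination of
the other vectors, from which it is disjoint; hence it would be zero. -/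
theorem IsDisjointSystem.coeff_nonneg {S : Finset Z} (hS : IsDisjointSystem S) (c : Z → ℝ)
    (h : 0 ≤ ∑ e ∈ S, c e • e) {e : Z} (he : e ∈ S) : 0 ≤ c e := by
  classical
  by_contra! hc
  have he0 := (hS.1 e he).1
  have hnn : ∀ f ∈ S.erase e, 0 ≤ |c f| • f := fun f hf =>
    smul_nonneg (abs_nonneg _) (hS.1 f (Finset.mem_of_mem_erase hf)).1
  have h1 : (-c e) • e ⊓ ∑ f ∈ S.erase e, |c f| • f = 0 := by
    refine inf_sum_eq_zero (smul_nonneg (by linarith) he0) _ _ hnn fun f hf => ?_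
    have hfS := Finset.mem_of_mem_erase hf
    have hf0 := (hS.1 f hfS).1
    refine inf_smul_eq_zero (smul_nonneg (by linarith) he0) hf0 ?_ (abs_nonneg _)
    rw [inf_comm]
    exact inf_smul_eq_zero hf0 he0 (hS.2 f hfS e he (Finset.ne_of_mem_erase hf)) (by linarith)
  have h2 : (-c e) • e ≤ ∑ f ∈ S.erase e, |c f| • f := by
    rw [← Finset.add_sum_erase _ _ he] at h
    have h3 : ∑ f ∈ S.erase e, c f • f ≤ ∑ f ∈ S.erase e, |c f| • f :=
      Finset.sum_le_sum fun f hf => smul_le_smul_of_nonneg_right (le_abs_self _)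
        (hS.1 f (Finset.mem_of_mem_erase hf)).1
    rw [neg_smul]
    exact (neg_le_iff_add_nonneg'.2 h).trans h3
  rw [inf_eq_left.2 h2, smul_eq_zero] at h1
  rcases h1 with h1 | h1
  · linarith
  · exact (hS.1 e he).2 h1

theorem IsDisjointSystem.linearIndepOn {S : Finset Z} (hS : IsDisjointSystem S) :
    LinearIndepOn ℝ id (S : Set Z) := by
  rw [linearIndepOn_finset_iff]
  intro c hc e he
  have h1 := hS.coeff_nonneg c hc.ge he
  have h2 := hS.coeff_nonneg (-c) (by simpa using hc.le) he
  simp only [Pi.neg_apply] at h2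
  linarith

theorem IsDisjointSystem.card_le [FiniteDimensional ℝ Z] {S : Finset Z}
    (hS : IsDisjointSystem S) : S.card ≤ Module.finrank ℝ Z := by
  have h := hS.linearIndepOn
  simpa using LinearIndependent.fintype_card_le_finrank h

theorem exists_maximal_isDisjointSystem (Z : Type*) [AddCommGroup Z] [Lattice Z]
    [IsOrderedAddMonoid Z] [Module ℝ Z] [IsOrderedModule ℝ Z] [FiniteDimensional ℝ Z] :
    ∃ S : Finset Z, IsDisjointSystem S ∧ ∀ T : Finset Z, IsDisjointSystem T → T.card ≤ S.card := by
  classical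
  let p : ℕ → Prop := fun n => ∃ S : Finset Z, IsDisjointSystem S ∧ S.card = n
  have h0 : p 0 := ⟨∅, ⟨by simp, by simp⟩, rfl⟩
  obtain ⟨S, hS, hc⟩ := Nat.findGreatest_spec (P := p) (Nat.zero_le (Module.finrank ℝ Z)) h0
  refine ⟨S, hS, fun T hT => ?_⟩
  rw [hc]
  exact Nat.le_findGreatest hT.card_le ⟨T, hT, rfl⟩

theorem IsDisjointSystem.eq_zero_of_inf_eq_zero {Z : Type*} [AddCommGroup Z] [Lattice Z]
    {S : Finset Z} (hS : IsDisjointSystem S)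
    (hmax : ∀ T : Finset Z, IsDisjointSystem T → T.card ≤ S.card) {w : Z} (hw : 0 ≤ w)
    (h : ∀ e ∈ S, w ⊓ e = 0) : w = 0 := by
  classical
  by_contra hw0
  have hwS : w ∉ S := fun hm => hw0 (by simpa using h w hm)
  have : IsDisjointSystem (insert w S) := by
    refine ⟨fun e he => ?_, fun e he f hf hef => ?_⟩
    · rcases Finset.mem_insert.1 he with rfl | he
      exacts [⟨hw, hw0⟩, hS.1 e he]
    · rcases Finset.mem_insert.1 he with rfl | he' <;>
        rcases Finset.mem_insert.1 hf with rfl | hf'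
      exacts [absurd rfl hef, h f hf', (inf_comm e _).trans (h e he'), hS.2 e he' f hf' hef]
  have := hmax _ this
  rw [Finset.card_insert_of_notMem hwS] at this
  omega

/-- Otherwise replacing `e` by the pair `x`, `y` would enlarge a system of maximal size. Thus the
members of such a system behave like atoms. -/
theorem IsDisjointSystem.eq_zero_or_eq_zero {S : Finset Z} (hS : IsDisjointSystem S)
    (hmax : ∀ T : Finset Z, IsDisjointSystem T → T.card ≤ S.card) {e : Z} (he : e ∈ S)
    {k : ℝ} (hk : 0 ≤ k) {x y : Z} (hx : 0 ≤ x) (hy : 0 ≤ y) (hxe : x ≤ k • e) (hye : y ≤ k • e)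
    (hxy : x ⊓ y = 0) : x = 0 ∨ y = 0 := by
  classical
  by_contra! h
  obtain ⟨hx0, hy0⟩ := h
  have key : ∀ z, 0 ≤ z → z ≤ k • e → ∀ f ∈ S.erase e, f ⊓ z = 0 := by
    intro z hz hze f hf
    have hfS := Finset.mem_of_mem_erase hf
    have hf0 := (hS.1 f hfS).1
    exact inf_eq_zero_of_le hf0 hz hze (inf_smul_eq_zero hf0 (hS.1 e he).1
      (hS.2 f hfS e he (Finset.ne_of_mem_erase hf)) hk)
  have hyS : y ∉ S.erase e := fun hm => hy0 (by simpa using key y hy hye y hm)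
  have hxS : x ∉ insert y (S.erase e) := by
    rw [Finset.mem_insert, not_or]
    refine ⟨?_, fun hm => hx0 (by simpa using key x hx hxe x hm)⟩
    rintro rfl
    exact hx0 (by simpa using hxy)
  have : IsDisjointSystem (insert x (insert y (S.erase e))) := by
    refine ⟨fun a ha => ?_, fun a ha b hb hab => ?_⟩
    · simp only [Finset.mem_insert] at ha
      rcases ha with rfl | rfl | ha
      exacts [⟨hx, hx0⟩, ⟨hy, hy0⟩, hS.1 a (Finset.mem_of_mem_erase ha)]
    · simp only [Finset.mem_insert] at ha hb
      rcases ha with rfl | rfl | ha <;> rcases hb with rfl | rfl | hb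
      · exact absurd rfl hab
      · exact hxy
      · rw [inf_comm]; exact key _ hx hxe b hb
      · rw [inf_comm]; exact hxy
      · exact absurd rfl hab
      · rw [inf_comm]; exact key _ hy hye b hb
      · exact key _ hx hxe a ha
      · exact key _ hy hye a ha
      · exact hS.2 a (Finset.mem_of_mem_erase ha) b (Finset.mem_of_mem_erase hb) hab
  have := hmax _ this
  rw [Finset.card_insert_of_notMem hxS, Finset.card_insert_of_notMem hyS,
    Finset.card_erase_of_mem he] at this
  have : 0 < S.card := Finset.card_pos.2 ⟨e, he⟩
  omega

theorem smul_le_of_forall_lt_of_archimedean (harch : ∀ x y : Z, (∀ m : ℕ, m • x ≤ y) → x ≤ 0)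
    {e x : Z} (he : 0 ≤ e) {l : ℝ} (h : ∀ t < l, t • e ≤ x) : l • e ≤ x := by
  rw [← sub_nonpos]
  refine harch _ e fun m => ?_
  rcases Nat.eq_zero_or_pos m with rfl | hm
  · simpa using he
  have hm' : (0 : ℝ) < m := Nat.cast_pos.2 hm
  have h1 := h (l - 1 / m) (by have := one_div_pos.2 hm'; linarith)
  have h2 : l • e - x ≤ (1 / (m : ℝ)) • e := by
    rw [sub_smul, sub_le_iff_le_add] at h1
    rw [sub_le_iff_le_add, add_comm]
    exact h1
  have h3 := smul_le_smul_of_nonneg_left h2 hm'.le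
  rwa [smul_smul, mul_one_div_cancel hm'.ne', one_smul, Nat.cast_smul_eq_nsmul] at h3

/-- The Archimedean property is used twice: it bounds the admissible scalars, since otherwise `e ≤
0`, and it shows that their supremum is attained. -/
theorem exists_greatest_smul_le (harch : ∀ x y : Z, (∀ m : ℕ, m • x ≤ y) → x ≤ 0)
    {e z : Z} (he : 0 ≤ e) (he0 : e ≠ 0) (hz : 0 ≤ z) :
    ∃ l : ℝ, 0 ≤ l ∧ l • e ≤ z ∧ ∀ t : ℝ, t • e ≤ z → t ≤ l := by
  let A : Set ℝ := {t | t • e ≤ z}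
  have h0 : (0 : ℝ) ∈ A := by simpa [A] using hz
  have hb : BddAbove A := by
    by_contra hb
    refine he0 (le_antisymm (harch e z fun m => ?_) he)
    rw [not_bddAbove_iff] at hb
    obtain ⟨t, ht, hmt⟩ := hb m
    rw [← Nat.cast_smul_eq_nsmul ℝ]
    exact (smul_le_smul_of_nonneg_right hmt.le he).trans ht
  refine ⟨sSup A, le_csSup hb h0, ?_, fun t ht => le_csSup hb ht⟩
  refine smul_le_of_forall_lt_of_archimedean harch he fun t ht => ?_
  obtain ⟨s, hs, hts⟩ := exists_lt_of_lt_csSup ⟨0, h0⟩ ht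
  exact (smul_le_smul_of_nonneg_right hts.le he).trans hs

/-- For every `t ≥ 0`, the positive and negative parts of `x - t • e` are disjoint and dominated by
a multiple of `e`, so one of them vanishes and `x` is comparable with `t • e`. With `l` the greatest
scalar such that `l • e ≤ x`, this gives `x ≤ t • e` for all `t > l`; then let `t` tend to `l`. -/
theorem IsDisjointSystem.exists_eq_smul (harch : ∀ x y : Z, (∀ m : ℕ, m • x ≤ y) → x ≤ 0)
    {S : Finset Z} (hS : IsDisjointSystem S)
    (hmax : ∀ T : Finset Z, IsDisjointSystem T → T.card ≤ S.card) {e : Z} (he : e ∈ S)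
    {x : Z} (hx : 0 ≤ x) (hxe : x ≤ e) : ∃ l : ℝ, x = l • e := by
  have he0 := (hS.1 e he).1
  obtain ⟨l, hl0, hl, hlmax⟩ := exists_greatest_smul_le harch he0 (hS.1 e he).2 hx
  refine ⟨l, le_antisymm ?_ hl⟩
  have key : ∀ t : ℝ, l < t → x ≤ t • e := by
    intro t ht
    have ht0 : 0 ≤ t := hl0.trans ht.le
    have hu : (x - t • e)⁺ ≤ (1 + t) • e := by
      refine sup_le ?_ (smul_nonneg (by linarith) he0)
      rw [add_smul, one_smul]
      exact (sub_le_self _ (smul_nonneg ht0 he0)).trans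
        (hxe.trans (le_add_of_nonneg_right (smul_nonneg ht0 he0)))
    have hv : (x - t • e)⁻ ≤ (1 + t) • e := by
      refine sup_le ?_ (smul_nonneg (by linarith) he0)
      rw [neg_sub, add_smul, one_smul]
      exact (sub_le_self _ hx).trans (le_add_of_nonneg_left he0)
    rcases hS.eq_zero_or_eq_zero hmax he (by linarith) (posPart_nonneg _) (negPart_nonneg _) hu hv
      (posPart_inf_negPart_eq_zero _) with h | h
    · rwa [posPart_eq_zero, sub_nonpos] at h
    · rw [negPart_eq_zero, sub_nonneg] at h
      exact absurd (hlmax t h) (not_le.2 ht)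
  have := smul_le_of_forall_lt_of_archimedean (x := -x) harch he0 (l := -l) fun t ht => by
    have := key (-t) (by linarith)
    rw [neg_smul] at this
    exact le_neg_of_le_neg this
  rw [neg_smul] at this
  exact neg_le_neg_iff.1 this

theorem IsDisjointSystem.exists_sub_smul_inf_eq_zero
    (harch : ∀ x y : Z, (∀ m : ℕ, m • x ≤ y) → x ≤ 0)
    {S : Finset Z} (hS : IsDisjointSystem S)
    (hmax : ∀ T : Finset Z, IsDisjointSystem T → T.card ≤ S.card) {e : Z} (he : e ∈ S)
    {z : Z} (hz : 0 ≤ z) : ∃ l : ℝ, 0 ≤ l ∧ l • e ≤ z ∧ (z - l • e) ⊓ e = 0 := by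
  have he0 := (hS.1 e he).1
  obtain ⟨l, hl0, hl, hlmax⟩ := exists_greatest_smul_le harch he0 (hS.1 e he).2 hz
  have hnn : 0 ≤ (z - l • e) ⊓ e := le_inf (sub_nonneg.2 hl) he0
  obtain ⟨u, hu⟩ := hS.exists_eq_smul harch hmax he hnn inf_le_right
  refine ⟨l, hl0, hl, le_antisymm ?_ hnn⟩
  have h1 : u • e ≤ z - l • e := hu ▸ inf_le_left
  -- The meet is a multiple `u • e`; it could be added to `l • e` without exceeding `z`, so
  -- maximality of `l` gives `u ≤ 0`.
  have h2 := hlmax (u + l) (by rw [add_smul]; exact le_sub_iff_add_le.1 h1)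
  rw [hu]
  exact smul_nonpos_of_nonpos_of_nonneg (by linarith) he0

/-- Remove the component along each member of `S` in turn. The remainder only decreases, so
disjointness already obtained persists; in the end it is disjoint from all of `S` and vanishes by
maximality. -/
theorem IsDisjointSystem.mem_span (harch : ∀ x y : Z, (∀ m : ℕ, m • x ≤ y) → x ≤ 0)
    {S : Finset Z} (hS : IsDisjointSystem S)
    (hmax : ∀ T : Finset Z, IsDisjointSystem T → T.card ≤ S.card) {z : Z} (hz : 0 ≤ z) :
    z ∈ Submodule.span ℝ (S : Set Z) := by
  classical
  have key : ∀ F ⊆ S, ∃ w : Z, 0 ≤ w ∧ z - w ∈ Submodule.span ℝ (S : Set Z) ∧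
      ∀ e ∈ F, w ⊓ e = 0 := by
    intro F
    induction F using Finset.induction_on with
    | empty => exact fun _ => ⟨z, hz, by simp, by simp⟩
    | insert a F ha ih =>
      intro hF
      obtain ⟨w, hw, hwS, hwF⟩ := ih ((Finset.subset_insert a F).trans hF)
      have haS : a ∈ S := hF (Finset.mem_insert_self a F)
      obtain ⟨l, hl0, hl, hla⟩ := hS.exists_sub_smul_inf_eq_zero harch hmax haS hw
      refine ⟨w - l • a, sub_nonneg.2 hl, ?_, fun e he => ?_⟩
      · rw [sub_sub_eq_add_sub, add_sub_right_comm]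
        exact add_mem hwS (Submodule.smul_mem _ _ (Submodule.subset_span haS))
      · rcases Finset.mem_insert.1 he with rfl | he
        · exact hla
        · have he0 := (hS.1 e (hF (Finset.mem_insert_of_mem he))).1
          rw [inf_comm]
          exact inf_eq_zero_of_le he0 (sub_nonneg.2 hl)
            (sub_le_self _ (smul_nonneg hl0 (hS.1 a haS).1)) (inf_comm e w ▸ hwF e he)
  obtain ⟨w, hw, hwS, hwF⟩ := key S subset_rfl
  rw [hS.eq_zero_of_inf_eq_zero hmax hw hwF, sub_zero] at hwS
  exact hwS

/-- A finite-dimensional Archimedean vector lattice has a basis of positive vectors whose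
coordinate functionals are positive. -/
theorem exists_positive_basis [FiniteDimensional ℝ Z]
    (harch : ∀ x y : Z, (∀ m : ℕ, m • x ≤ y) → x ≤ 0) :
    ∃ (k : ℕ) (b : Module.Basis (Fin k) ℝ Z), (∀ i, 0 ≤ b i) ∧
      ∀ z, 0 ≤ z → ∀ i, 0 ≤ b.repr z i := by
  classical
  obtain ⟨S, hS, hmax⟩ := exists_maximal_isDisjointSystem Z
  have hspan : ⊤ ≤ Submodule.span ℝ (Set.range fun e : (S : Set Z) => id e.1) := by
    intro z _
    rw [show (Set.range fun e : (S : Set Z) => id e.1) = S from Subtype.range_coe,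
      ← posPart_sub_negPart z]
    exact sub_mem (hS.mem_span harch hmax (posPart_nonneg z))
      (hS.mem_span harch hmax (negPart_nonneg z))
  let b : Module.Basis S ℝ Z := Module.Basis.mk hS.linearIndepOn hspan
  have hb : ∀ e : S, b e = e := fun e => Module.Basis.mk_apply _ _ _
  refine ⟨S.card, b.reindex S.equivFin, fun i => ?_, fun z hz i => ?_⟩
  · rw [Module.Basis.reindex_apply, hb]
    exact (hS.1 _ (Subtype.prop _)).1
  · rw [Module.Basis.repr_reindex_apply]
    set e := S.equivFin.symm i
    have h : 0 ≤ ∑ f ∈ S, (if hf : f ∈ S then b.repr z ⟨f, hf⟩ else 0) • f := by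
      rw [← Finset.sum_attach]
      refine hz.trans_eq ?_
      conv_lhs => rw [← b.sum_repr z]
      exact Finset.sum_congr rfl fun f _ => by simp [hb]
    simpa using hS.coeff_nonneg _ h e.2

end VectorLattice

/-! ### From positive factorizations to sums of positive tensors. -/

theorem HasPositiveFactorization.isSumOfPositiveTensors {X Y : Type*} [AddCommGroup X]
    [PartialOrder X] [IsOrderedAddMonoid X] [Module ℝ X] [AddCommGroup Y] [PartialOrder Y]
    [Module ℝ Y] {T : X →ₗ[ℝ] Y} {n : ℕ} (h : HasPositiveFactorization T n) :
    IsSumOfPositiveTensors T := by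
  obtain ⟨Z, _, _, _, _, _, _, -, harch, R, L, hT⟩ := h
  obtain ⟨k, b, hb, hrepr⟩ := exists_positive_basis harch
  refine ⟨k, fun i => L (b i), fun i => PositiveLinearMap.mk₀ (b.coord i ∘ₗ R.toLinearMap)
    fun x hx => hrepr _ (by simpa using R.map_nonneg hx) i, fun i => L.map_nonneg (hb i),
    fun x => ?_⟩
  rw [hT, ← b.sum_repr (R x), map_sum]
  simp [PositiveLinearMap.mk₀]
  rfl

theorem nonnegRank_eq_top {X Y : Type*} [AddCommGroup X]
    [PartialOrder X] [IsOrderedAddMonoid X] [Module ℝ X] [AddCommGroup Y] [PartialOrder Y]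
    [Module ℝ Y] {T : X →ₗ[ℝ] Y} (h : ¬ IsSumOfPositiveTensors T) : nonnegRank T = ⊤ := by
  simp only [nonnegRank, iInf_eq_top]
  exact fun n hn => absurd hn.isSumOfPositiveTensors h

/-! ### Lebesgue measure on the interval, and the rank of the operator. -/

theorem IccTwoPi.volume_apply (U : Set IccTwoPi) :
    volume U = volume (Subtype.val '' U : Set ℝ) :=
  (MeasurableEmbedding.subtype_coe measurableSet_Icc).comap_apply _ _

instance IccTwoPi.nullSingletonClass : NullSingletonClass (volume : Measure IccTwoPi) where
  measure_singleton a := by simp [IccTwoPi.volume_apply]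

instance IccTwoPi.isOpenPosMeasure : (volume : Measure IccTwoPi).IsOpenPosMeasure where
  open_pos := by
    rintro _ ⟨V, hV, rfl⟩ ⟨x, hx⟩ h0
    -- A relatively open set may touch the interval at an endpoint; density of the open interval
    -- still yields a nonempty open subset of `ℝ` inside it.
    have hx' : (x : ℝ) ∈ closure (Set.Ioo 0 (2 * Real.pi)) := by
      rw [closure_Ioo Real.two_pi_pos.ne]
      exact x.2
    have hne := mem_closure_iff.1 hx' V hV hx
    refine ((hV.inter isOpen_Ioo).measure_pos volume hne).ne' (measure_mono_null ?_
      ((IccTwoPi.volume_apply _).symm.trans h0))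
    rintro t ⟨htV, ht⟩
    exact ⟨⟨t, Set.Ioo_subset_Icc_self ht⟩, htV, rfl⟩

/-- The Fourier coefficients of `f` against `1`, `cos` and `sin`, without normalization. -/
noncomputable def trigCoeff (f : IccTwoPi → ℝ) : Fin 3 → ℝ :=
  ![∫ t, f t, ∫ t, f t * Real.cos t, ∫ t, f t * Real.sin t]

/-- The trigonometric polynomial `v₀ + v₁ cos + v₂ sin` on `[0, 2π]`. -/
noncomputable def trigPoly : (Fin 3 → ℝ) →ₗ[ℝ] C(IccTwoPi, ℝ) where
  toFun v := ⟨fun s => v 0 + v 1 * Real.cos s + v 2 * Real.sin s, by fun_prop⟩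
  map_add' v w := by
    ext s
    simp only [Pi.add_apply, ContinuousMap.coe_mk, ContinuousMap.add_apply]
    ring
  map_smul' c v := by
    ext s
    simp only [Pi.smul_apply, smul_eq_mul, ContinuousMap.coe_mk, ContinuousMap.smul_apply,
      RingHom.id_apply]
    ring

theorem cosIntegral_eq_trigPoly {f : IccTwoPi → ℝ} (hf : Integrable f) :
    cosIntegral f = trigPoly (trigCoeff f) := by
  have hc : Integrable fun t : IccTwoPi => f t * Real.cos t :=
    hf.mul_bdd (c := 1) (by fun_prop) (.of_forall fun _ => Real.abs_cos_le_one _)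
  have hs : Integrable fun t : IccTwoPi => f t * Real.sin t :=
    hf.mul_bdd (c := 1) (by fun_prop) (.of_forall fun _ => Real.abs_sin_le_one _)
  funext s
  have h : ∀ t : IccTwoPi, f t * (1 + Real.cos ((s : ℝ) - t)) =
      f t + (f t * Real.cos t) * Real.cos s + (f t * Real.sin t) * Real.sin s := fun t => by
    rw [Real.cos_sub]; ring
  simp only [cosIntegral, h]
  rw [integral_add (f := fun t : IccTwoPi => f t + f t * Real.cos t * Real.cos s)
    (hf.add (hc.mul_const _)) (hs.mul_const _), integral_add hf (hc.mul_const _),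
    integral_mul_const, integral_mul_const]
  rfl

theorem IccTwoPi.integral_eq_sub_of_hasDerivAt {F f : ℝ → ℝ} (hF : ∀ t, HasDerivAt F (f t) t)
    (hf : Continuous f) : ∫ t : IccTwoPi, f t = F (2 * Real.pi) - F 0 := by
  rw [integral_subtype measurableSet_Icc f, integral_Icc_eq_integral_Ioc,
    ← intervalIntegral.integral_of_le Real.two_pi_pos.le]
  exact intervalIntegral.integral_eq_sub_of_hasDerivAt (fun t _ => hF t)
    (hf.intervalIntegrable _ _)

theorem trigCoeff_trigPoly (v : Fin 3 → ℝ) :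
    trigCoeff (trigPoly v) = ![2 * Real.pi * v 0, Real.pi * v 1, Real.pi * v 2] := by
  have h0 := IccTwoPi.integral_eq_sub_of_hasDerivAt
    (F := fun t => v 0 * t + v 1 * Real.sin t - v 2 * Real.cos t)
    (f := fun t => v 0 + v 1 * Real.cos t + v 2 * Real.sin t)
    (fun t => ((((hasDerivAt_id t).const_mul (v 0)).add
      ((Real.hasDerivAt_sin t).const_mul (v 1))).sub
      ((Real.hasDerivAt_cos t).const_mul (v 2))).congr_deriv (by ring)) (by fun_prop)
  have h1 := IccTwoPi.integral_eq_sub_of_hasDerivAt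
    (F := fun t => v 0 * Real.sin t + v 1 * ((t + Real.sin t * Real.cos t) / 2) +
      v 2 * (Real.sin t ^ 2 / 2))
    (f := fun t => (v 0 + v 1 * Real.cos t + v 2 * Real.sin t) * Real.cos t)
    (fun t => ((((Real.hasDerivAt_sin t).const_mul (v 0)).add
      ((((hasDerivAt_id t).add ((Real.hasDerivAt_sin t).mul
        (Real.hasDerivAt_cos t))).div_const 2).const_mul (v 1))).add
      ((((Real.hasDerivAt_sin t).pow 2).div_const 2).const_mul (v 2))).congr_deriv (by
        simp only [Nat.cast_ofNat, Nat.add_one_sub_one, pow_one]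
        linear_combination (v 1 / 2) * (Real.sin_sq_add_cos_sq t).symm)) (by fun_prop)
  have h2 := IccTwoPi.integral_eq_sub_of_hasDerivAt
    (F := fun t => v 1 * (Real.sin t ^ 2 / 2) + v 2 * ((t - Real.sin t * Real.cos t) / 2) -
      v 0 * Real.cos t)
    (f := fun t => (v 0 + v 1 * Real.cos t + v 2 * Real.sin t) * Real.sin t)
    (fun t => (((((Real.hasDerivAt_sin t).pow 2).div_const 2).const_mul (v 1)).add
      ((((hasDerivAt_id t).sub ((Real.hasDerivAt_sin t).mul
        (Real.hasDerivAt_cos t))).div_const 2).const_mul (v 2)) |>.sub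
      ((Real.hasDerivAt_cos t).const_mul (v 0))).congr_deriv (by
        simp only [Nat.cast_ofNat, Nat.add_one_sub_one, pow_one]
        linear_combination (v 2 / 2) * (Real.sin_sq_add_cos_sq t).symm)) (by fun_prop)
  simp only [Real.sin_two_pi, Real.cos_two_pi, Real.sin_zero, Real.cos_zero] at h0 h1 h2
  have e0 : trigCoeff (trigPoly v) 0 = 2 * Real.pi * v 0 := h0.trans (by ring)
  have e1 : trigCoeff (trigPoly v) 1 = Real.pi * v 1 := h1.trans (by ring)
  have e2 : trigCoeff (trigPoly v) 2 = Real.pi * v 2 := h2.trans (by ring)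
  ext i
  fin_cases i
  exacts [e0, e1, e2]

theorem trigCoeff_congr {f g : IccTwoPi → ℝ} (h : f =ᵐ[volume] g) :
    trigCoeff f = trigCoeff g := by
  have h1 : ∀ w : IccTwoPi → ℝ, ∫ t, f t * w t = ∫ t, g t * w t := fun w =>
    integral_congr_ae (h.mono fun t ht => by simp only [ht])
  rw [trigCoeff, trigCoeff, integral_congr_ae h, h1, h1]

/-- Since `A ∘ P` is diagonal with nonzero entries, `P` is injective and every `P v` is reached by
rescaling coordinates; so `T` and `P` have the same three-dimensional range. -/
theorem rank_eq_three {X : Type} [AddCommGroup X] [Module ℝ X] {T : X →ₗ[ℝ] X}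
    (P : (Fin 3 → ℝ) →ₗ[ℝ] X) (A : X → Fin 3 → ℝ) (hT : ∀ x, T x = P (A x))
    (hA : ∀ v, A (P v) = ![2 * Real.pi * v 0, Real.pi * v 1, Real.pi * v 2]) :
    LinearMap.rank T = 3 := by
  have hpi := Real.pi_ne_zero
  have hP : Function.Injective P := by
    intro v w h
    have h' := congrArg A h
    rw [hA, hA] at h'
    have e0 := congrFun h' 0
    have e1 := congrFun h' 1
    have e2 := congrFun h' 2
    simp [hpi] at e0 e1 e2
    ext i
    fin_cases i
    exacts [e0, e1, e2]
  have hr : LinearMap.range T = LinearMap.range P := by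
    ext x
    constructor
    · rintro ⟨u, rfl⟩
      exact ⟨A u, (hT u).symm⟩
    · rintro ⟨v, rfl⟩
      refine ⟨P ![v 0 / (2 * Real.pi), v 1 / Real.pi, v 2 / Real.pi], ?_⟩
      rw [hT, hA]
      congr 1
      ext i
      fin_cases i <;> simp <;> field_simp
  rw [LinearMap.rank, hr, rank_range_of_injective P hP]
  simp

theorem rank_opC : LinearMap.rank opC = 3 :=
  rank_eq_three trigPoly (fun f => trigCoeff f)
    (fun f => DFunLike.coe_injective
      (cosIntegral_eq_trigPoly (IccTwoPi.integrable_continuousMap f)))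
    trigCoeff_trigPoly

theorem rank_opLp (p : ℝ≥0∞) [Fact (1 ≤ p)] : LinearMap.rank (opLp p) = 3 := by
  refine rank_eq_three ((ContinuousMap.toLp p volume ℝ).toLinearMap ∘ₗ trigPoly)
    (fun f => trigCoeff f) (fun f => ?_) (fun v => ?_)
  · refine Lp.ext ?_
    refine (MemLp.coeFn_toLp (memLp_cosIntegral (IccTwoPi.integrable_Lp f) p)).trans ?_
    rw [cosIntegral_eq_trigPoly (IccTwoPi.integrable_Lp f)]
    exact (ContinuousMap.coeFn_toLp volume _).symm
  · rw [← trigCoeff_trigPoly]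
    exact trigCoeff_congr (ContinuousMap.coeFn_toLp volume _)

/-! ### Positivity, and the comparison of kernels at two points. -/

theorem cosIntegral_nonneg {f : IccTwoPi → ℝ} (hf : 0 ≤ᵐ[volume] f) (s : IccTwoPi) :
    0 ≤ cosIntegral f s :=
  integral_nonneg_of_ae (hf.mono fun t ht =>
    mul_nonneg ht (by linarith [Real.neg_one_le_cos ((s : ℝ) - t)]))

/-- If finitely many nonnegative functions generate all `a i` with nonnegative coefficients, then
the values of the `a i` at some two distinct points are comparable, uniformly in `i`: two points at
which the same generators are nonzero will do. -/
theorem exists_ne_forall_le_mul {α ι : Type*} {k : ℕ} {G : Set α} (hG : G.Infinite)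
    {y : Fin k → α → ℝ} (hy : ∀ s ∈ G, ∀ j, 0 ≤ y j s) {a : ι → α → ℝ} {c : ι → Fin k → ℝ}
    (hc : ∀ i j, 0 ≤ c i j) (h : ∀ i, ∀ s ∈ G, a i s = ∑ j, c i j * y j s) :
    ∃ s ∈ G, ∃ s' ∈ G, s ≠ s' ∧ ∃ C : ℝ, ∀ i, a i s ≤ C * a i s' := by
  -- Pigeonhole: infinitely many points, finitely many sets of vanishing generators.
  obtain ⟨s, hs, s', hs', hne, hJ⟩ := hG.exists_ne_map_eq_of_mapsTo
    (f := fun s => {j | y j s = 0}) (t := Set.univ) (fun _ _ => Set.mem_univ _) Set.finite_univ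
  -- The sum bounds each single ratio. Where `y j s' = 0` the quotient is `0` by convention, which
  -- is harmless since `y j s = 0` too.
  refine ⟨s, hs, s', hs', hne, ∑ j, y j s / y j s', fun i => ?_⟩
  rw [h i s hs, h i s' hs', Finset.mul_sum]
  refine Finset.sum_le_sum fun j _ => ?_
  have hnn : ∀ l, 0 ≤ y l s / y l s' := fun l => div_nonneg (hy s hs l) (hy s' hs' l)
  rw [mul_left_comm]
  refine mul_le_mul_of_nonneg_left ?_ (hc i j)
  by_cases hj : y j s' = 0
  · have hj' : y j s = 0 := (Set.ext_iff.1 hJ j).2 hj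
    simp [hj, hj']
  · calc y j s = y j s / y j s' * y j s' := (div_mul_cancel₀ _ hj).symm
      _ ≤ _ := mul_le_mul_of_nonneg_right
        (Finset.single_le_sum (fun l _ => hnn l) (Finset.mem_univ j)) (hy s' hs' j)

theorem continuous_integral_continuousMap :
    Continuous fun f : C(IccTwoPi, ℝ) => ∫ t, f t := by
  have h := continuous_integral.comp (ContinuousMap.toLp 1 (volume : Measure IccTwoPi) ℝ
    (E := ℝ)).continuous
  convert h using 2 with f
  exact (integral_congr_ae (ContinuousMap.coeFn_toLp volume f)).symm

theorem IccTwoPi.eq_zero_of_integral_pow_nonpos {f : C(IccTwoPi, ℝ)} (hf : 0 ≤ f)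
    (h : ∫ t, f t ^ 3 ≤ 0) (t : IccTwoPi) : f t = 0 := by
  have hnn : 0 ≤ fun t => f t ^ 3 := fun t => pow_nonneg (hf t) 3
  have h0 := le_antisymm h (integral_nonneg hnn)
  rw [integral_eq_zero_iff_of_nonneg hnn
    (IccTwoPi.integrable_continuousMap (f ^ 3))] at h0
  have h1 := (Continuous.ae_eq_iff_eq volume (by fun_prop) continuous_const).1 h0
  exact pow_eq_zero_iff (three_ne_zero) |>.1 (congrFun h1 t)

/-- Squares serve as test functions because they are nonnegative and depend continuously on `d`: the
inequality extends from `D` to all squares without approximating inside the positive cone. -/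
theorem eq_of_forall_cosIntegral_le {D : Set C(IccTwoPi, ℝ)} (hD : Dense D) {s s' : IccTwoPi}
    (hs : (s : ℝ) ∈ Set.Ioo 0 (2 * Real.pi)) (hs' : (s' : ℝ) ∈ Set.Ioo 0 (2 * Real.pi)) {C : ℝ}
    (h : ∀ d ∈ D, cosIntegral ⇑(d * d) s ≤ C * cosIntegral ⇑(d * d) s') : s = s' := by
  let K : IccTwoPi → C(IccTwoPi, ℝ) := fun s => ⟨fun t => 1 + Real.cos ((s : ℝ) - t), by fun_prop⟩
  have hK : ∀ (f : C(IccTwoPi, ℝ)) (s : IccTwoPi), cosIntegral f s = ∫ t, (f * K s) t :=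
    fun _ _ => rfl
  have hall : ∀ f : C(IccTwoPi, ℝ), cosIntegral ⇑(f * f) s ≤ C * cosIntegral ⇑(f * f) s' := by
    simp only [hK] at h ⊢
    have hcl : IsClosed {f : C(IccTwoPi, ℝ) |
        ∫ t, (f * f * K s) t ≤ C * ∫ t, (f * f * K s') t} :=
      isClosed_le (continuous_integral_continuousMap.comp (by fun_prop))
        ((continuous_integral_continuousMap.comp (by fun_prop)).const_mul C)
    intro f
    exact closure_minimal h hcl (hD f)
  let g : C(IccTwoPi, ℝ) := C • K s' - K s
  have hg : ∀ t, 0 ≤ g t := by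
    intro t
    -- Testing on `(g⁻)²` gives `0 ≤ ∫ (g⁻)² g = -∫ (g⁻)³`, so `g⁻` vanishes.
    have h1 := hall (g⁻)
    rw [hK, hK, ← integral_const_mul, ← sub_nonneg, ← integral_sub
      ((IccTwoPi.integrable_continuousMap _).const_mul C)
      (IccTwoPi.integrable_continuousMap _)] at h1
    have h2 : ∀ t, C * (g⁻ * g⁻ * K s') t - (g⁻ * g⁻ * K s) t = -((g⁻) t ^ 3) := by
      intro t
      have e1 : (g⁻) t = max (-(g t)) 0 := rfl
      have e2 : C * (g⁻ * g⁻ * K s') t - (g⁻ * g⁻ * K s) t = (g⁻) t ^ 2 * g t := by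
        simp only [g, ContinuousMap.mul_apply, ContinuousMap.sub_apply, ContinuousMap.smul_apply,
          smul_eq_mul]
        ring
      rw [e2, e1]
      rcases le_total 0 (g t) with h | h
      · rw [max_eq_right (by linarith)]; ring
      · rw [max_eq_left (by linarith)]; ring
    simp only [h2, integral_neg, neg_nonneg] at h1
    have h3 := IccTwoPi.eq_zero_of_integral_pow_nonpos (negPart_nonneg g) h1 t
    have e1 : (g⁻) t = max (-(g t)) 0 := rfl
    rw [e1, max_eq_right_iff] at h3
    linarith
  -- The point antipodal to `s'`, where the kernel at `s'` vanishes; the sign of the shift by `π`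
  -- keeps it in the interval.
  obtain ⟨t, ht⟩ : ∃ t : IccTwoPi, ∀ x : ℝ, Real.cos (x - t) = -Real.cos (x - s') := by
    rcases le_total (s' : ℝ) Real.pi with hle | hle
    · refine ⟨⟨s' + Real.pi, by linarith [hs'.1, Real.pi_pos], by linarith⟩, fun x => ?_⟩
      rw [← Real.cos_sub_pi]
      congr 1
      ring
    · refine ⟨⟨s' - Real.pi, by linarith, by linarith [hs'.2, Real.pi_pos]⟩, fun x => ?_⟩
      rw [← Real.cos_add_pi]
      congr 1
      ring
  have h1 : 0 ≤ C * (1 + Real.cos ((s' : ℝ) - t)) - (1 + Real.cos ((s : ℝ) - t)) := hg t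
  rw [ht, ht, sub_self, Real.cos_zero] at h1
  have h2 : Real.cos ((s : ℝ) - s') = 1 :=
    le_antisymm (Real.cos_le_one _) (by linarith)
  -- Interior points satisfy `|s - s'| < 2π`. The endpoints must be excluded, as `0` and `2π` give
  -- the same kernel.
  rw [Real.cos_eq_one_iff_of_lt_of_lt (by linarith [hs.1, hs'.2]) (by linarith [hs.2, hs'.1])] at h2
  exact Subtype.ext (by linarith)

theorem IccTwoPi.ae_mem_Ioo :
    ∀ᵐ s : IccTwoPi, (s : ℝ) ∈ Set.Ioo 0 (2 * Real.pi) := by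
  have h : ∀ a : IccTwoPi, ∀ᵐ s : IccTwoPi, s ≠ a := fun a => by
    simp [ae_iff]
  filter_upwards [h ⟨0, by simp [Real.pi_pos.le]⟩, h ⟨2 * Real.pi, by simp [Real.pi_pos.le]⟩]
    with s h0 h1
  exact ⟨lt_of_le_of_ne s.2.1 fun h => h0 (Subtype.ext h.symm),
    lt_of_le_of_ne s.2.2 fun h => h1 (Subtype.ext h)⟩

/-- The common core of both cases. The functionals enter only through the nonnegative numbers `c d
j`, so no continuity of them is needed. -/
theorem false_of_ae_cosIntegral_eq_sum {k : ℕ} {y : Fin k → IccTwoPi → ℝ}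
    (hy : ∀ᵐ s : IccTwoPi, ∀ j, 0 ≤ y j s)
    {c : C(IccTwoPi, ℝ) → Fin k → ℝ} (hc : ∀ d j, 0 ≤ c d j)
    (h : ∀ d : C(IccTwoPi, ℝ), ∀ᵐ s : IccTwoPi, cosIntegral ⇑(d * d) s = ∑ j, c d j * y j s) :
    False := by
  -- The exceptional null set depends on `d`; countability of `D` allows a single one for all `d ∈
  -- D`.
  obtain ⟨D, hDc, hD⟩ := TopologicalSpace.exists_countable_dense C(IccTwoPi, ℝ)
  have := hDc.to_subtype
  have hae : ∀ᵐ s : IccTwoPi, (s : ℝ) ∈ Set.Ioo 0 (2 * Real.pi) ∧ (∀ j, 0 ≤ y j s) ∧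
      ∀ d : D, cosIntegral ⇑((d : C(IccTwoPi, ℝ)) * d) s = ∑ j, c d j * y j s :=
    IccTwoPi.ae_mem_Ioo.and (hy.and (ae_all_iff.2 fun d => h d))
  have hinf : {s : IccTwoPi | (s : ℝ) ∈ Set.Ioo 0 (2 * Real.pi) ∧ (∀ j, 0 ≤ y j s) ∧
      ∀ d : D, cosIntegral ⇑((d : C(IccTwoPi, ℝ)) * d) s = ∑ j, c d j * y j s}.Infinite := by
    -- A finite set is null, whereas this set has null complement in a space of positive measure.
    intro hfin
    have h0 : ∀ᵐ s : IccTwoPi, False := by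
      filter_upwards [hae, measure_eq_zero_iff_ae_notMem.1 (hfin.measure_zero volume)] with s h1 h2
      exact h2 h1
    have h1 : volume (Set.univ : Set IccTwoPi) = 0 := by simpa [ae_iff] using h0
    rw [Measure.Subtype.volume_univ measurableSet_Icc.nullMeasurableSet] at h1
    simp [Real.volume_Icc, Real.pi_pos.not_ge] at h1
  obtain ⟨s, hs, s', hs', hne, C, hC⟩ := exists_ne_forall_le_mul hinf (fun s hs => hs.2.1)
    (a := fun (d : D) s => cosIntegral ⇑((d : C(IccTwoPi, ℝ)) * d) s) (c := fun d => c d)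
    (fun d => hc d) (fun d s hs => hs.2.2 d)
  exact hne (eq_of_forall_cosIntegral_le hD hs.1 hs'.1 fun d hd => hC ⟨d, hd⟩)

/-! ### Conclusion for continuous functions and for `L^p`. -/

theorem not_isSumOfPositiveTensors_opC : ¬ IsSumOfPositiveTensors opC := by
  rintro ⟨k, y, φ, hy, h⟩
  refine false_of_ae_cosIntegral_eq_sum (y := fun j => y j) (c := fun d j => φ j (d * d))
    (.of_forall fun s j => hy j s) (fun d j => (φ j).map_nonneg fun t => mul_self_nonneg (d t))
    fun d => .of_forall fun s => ?_
  have hs : cosIntegral ⇑(d * d) s = _ := DFunLike.congr_fun (h (d * d)) s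
  simpa only [ContinuousMap.sum_apply, ContinuousMap.smul_apply, smul_eq_mul] using hs

theorem Lp.coeFn_sum_smul {α ι : Type*} [MeasurableSpace α] {μ : Measure α} {p : ℝ≥0∞}
    (s : Finset ι) (c : ι → ℝ) (y : ι → Lp ℝ p μ) :
    ⇑(∑ j ∈ s, c j • y j) =ᵐ[μ] fun x => ∑ j ∈ s, c j * y j x := by
  filter_upwards [Lp.coeFn_finsetSum s fun j => c j • y j,
    s.eventually_all.2 fun j _ => Lp.coeFn_smul (c j) (y j)] with x h1 h2
  rw [h1, Finset.sum_apply]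
  exact Finset.sum_congr rfl fun j hj => h2 j hj

theorem not_isSumOfPositiveTensors_opLp (p : ℝ≥0∞) [Fact (1 ≤ p)] :
    ¬ IsSumOfPositiveTensors (opLp p) := by
  rintro ⟨k, y, φ, hy, h⟩
  let ι : C(IccTwoPi, ℝ) → Lp ℝ p (volume : Measure IccTwoPi) :=
    fun d => ContinuousMap.toLp p volume ℝ (d * d)
  have hι : ∀ d, ι d =ᵐ[volume] ⇑(d * d) := fun d => ContinuousMap.coeFn_toLp volume _
  refine false_of_ae_cosIntegral_eq_sum (y := fun j => y j) (c := fun d j => φ j (ι d))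
    (ae_all_iff.2 fun j => (Lp.coeFn_nonneg _).2 (hy j)) (fun d j => (φ j).map_nonneg ?_)
    fun d => ?_
  · rw [← Lp.coeFn_nonneg]
    filter_upwards [hι d] with t ht
    rw [ht]
    exact mul_self_nonneg (d t)
  · rw [← cosIntegral_congr (hι d)]
    refine (MemLp.coeFn_toLp (memLp_cosIntegral (IccTwoPi.integrable_Lp (ι d)) p)).symm.trans ?_
    change ⇑(opLp p (ι d)) =ᵐ[volume] _
    rw [h]
    exact Lp.coeFn_sum_smul _ _ _

theorem opC_nonneg (f : C(IccTwoPi, ℝ)) (hf : 0 ≤ f) : 0 ≤ opC f :=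
  fun s => cosIntegral_nonneg (.of_forall fun t => hf t) s

theorem opLp_nonneg (p : ℝ≥0∞) [Fact (1 ≤ p)] (f : Lp ℝ p (volume : Measure IccTwoPi))
    (hf : 0 ≤ f) : 0 ≤ opLp p f := by
  rw [← Lp.coeFn_nonneg] at hf ⊢
  filter_upwards [MemLp.coeFn_toLp (memLp_cosIntegral (IccTwoPi.integrable_Lp f) p)] with s hs
  exact (cosIntegral_nonneg hf s).trans_eq hs.symm

theorem theorem4p4 :
    ((∀ f : C(IccTwoPi, ℝ), 0 ≤ f → 0 ≤ opC f) ∧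
      LinearMap.rank opC = 3 ∧
      nonnegRank opC = ⊤ ∧
      ¬ IsSumOfPositiveTensors opC) ∧
    ∀ (p : ℝ≥0∞) [Fact (1 ≤ p)],
      (∀ f : Lp ℝ p (volume : Measure IccTwoPi), 0 ≤ f → 0 ≤ opLp p f) ∧
      LinearMap.rank (opLp p) = 3 ∧
      nonnegRank (opLp p) = ⊤ ∧
      ¬ IsSumOfPositiveTensors (opLp p) :=
  ⟨⟨opC_nonneg, rank_opC, nonnegRank_eq_top not_isSumOfPositiveTensors_opC,
    not_isSumOfPositiveTensors_opC⟩, fun p _ => ⟨opLp_nonneg p, rank_opLp p,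
    nonnegRank_eq_top (not_isSumOfPositiveTensors_opLp p), not_isSumOfPositiveTensors_opLp p⟩⟩
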